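/- Let $n\ge 0$ and let $k_1,\dots,k_n$ be positive integers. Let $K=\prod_{i=1}^n\{0,1,\dots,k_i-1\}$ be the corresponding discrete box of dimension $n$, endowed with the metric $d(x,y)=\max_{1\le i\le n}|x(i)-y(i)|$ (with $d=0$ if $n=0$). Let $\mathcal F$ be a cover of $K$, that is, a set of subsets of $K$ whose union is $K$. Then at least one of the following holds: 1. some $F\in\mathcal F$ connects two opposite faces of $K$: there are $i\in\{1,\dots,n\}$, an integer $m\ge 0$ and points $x_0,\dots,x_m\in F$ such that $x_0(i)=0$, $x_m(i)=k_i-1$, and $d(x_{j-1},x_j)\le 1$ for all $j\in\{1,\dots,m\}$; 2. there is a subset $B\subseteq K$ of diameter at most $1$ that intersects at least $n+1$ distinct elements of $\mathcal F$. -/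

import Mathlib

/-- The discrete box `k₁ × ⋯ × kₙ`, where each `kᵢ` is identified with `{0, …, kᵢ - 1}`: the set of
all functions `x : Fin n → ℕ` with `x i < k i` for every `i`. The ambient type `Fin n → ℕ` carries
the sup metric `dist x y = maxᵢ |x i - y i|` of Mathlib. -/
def discreteBox {n : ℕ} (k : Fin n → ℕ) : Set (Fin n → ℕ) :=
  {x | ∀ i, x i < k i}

/-- The set `A` connects two opposite faces of the box `k₁ × ⋯ × kₙ`: for some coordinate `i` there
is a finite sequence `x₀, …, xₘ` of points of `A` with `x₀(i) = 0`, `xₘ(i) = kᵢ - 1`, and all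
consecutive distances at most `1`. -/
def ConnectsOppositeFaces {n : ℕ} (k : Fin n → ℕ) (A : Set (Fin n → ℕ)) : Prop :=
  ∃ (i : Fin n) (m : ℕ) (x : Fin (m + 1) → (Fin n → ℕ)),
    (∀ j, x j ∈ A) ∧ x 0 i = 0 ∧ x (Fin.last m) i + 1 = k i ∧
      ∀ j : Fin m, dist (x j.castSucc) (x j.succ) ≤ 1

/-! Suppose no member of the cover connects opposite faces. Choose for each `x` a member `A x`
containing it, and label `x` by `faceLabel` of its chain component in `A x`. Label `j.succ` says
that the component misses the face `x j = 0`; a label at most `j.castSucc` says that it meets this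
face, so it cannot meet the opposite one. These are the boundary conditions of a cubical Sperner
lemma, which yields a Kuhn simplex carrying all `n + 1` labels. Two vertices of it in the same
chosen set would share a component, hence a label; so its vertices lie in `n + 1` distinct sets. The
Sperner lemma (`IsSpernerLabelling.odd_card_rainbow`) is an induction on dimension that counts doors
modulo 2, with `kuhnPivot` pairing off the interior ones. -/

open Finset in
/-- The parity count behind Sperner's lemma: a self-map of a finite type either is a bijection and has
exactly one point whose removal keeps all values other than `a`, or has an even number of them. -/
theorem card_doors_mod_two {α : Type*} [Fintype α] [DecidableEq α] (a : α) (g : α → α) :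
    (#{i | ∀ l ≠ a, ∃ m ≠ i, g m = l}) % 2 = if Function.Surjective g then 1 else 0 := by
  split_ifs with hs
  · have hinj := Finite.injective_iff_surjective.mpr hs
    obtain ⟨i₀, hi₀⟩ := hs a
    have : ({i | ∀ l ≠ a, ∃ m ≠ i, g m = l} : Finset α) = {i₀} := by
      ext i
      simp only [mem_filter, mem_univ, true_and, mem_singleton]
      constructor
      · intro h
        by_contra hne
        obtain ⟨m, hm, hg⟩ := h (g i) (fun h' => hne (hinj (h'.trans hi₀.symm)))
        exact hm (hinj hg)
      · rintro rfl l hl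
        obtain ⟨m, rfl⟩ := hs l
        exact ⟨m, fun h => hl (h ▸ hi₀), rfl⟩
    rw [this, card_singleton]
  · by_cases hd : ∃ i, ∀ l ≠ a, ∃ m ≠ i, g m = l
    · obtain ⟨i, hi⟩ := hd
      have hgi : g i ≠ a := by
        intro h
        apply hs
        intro l
        by_cases hl : l = a
        · exact ⟨i, h.trans hl.symm⟩
        · obtain ⟨m, -, hm⟩ := hi l hl
          exact ⟨m, hm⟩
      -- Removing `i` leaves one point for each value other than `a`, and all these values are
      -- attained.
      have hinj : Set.InjOn g ((univ.erase i : Finset α) : Set α) := by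
        apply Finset.injOn_of_card_image_eq
        apply le_antisymm card_image_le
        have hsub : univ.erase a ⊆ (univ.erase i).image g := by
          intro l hl
          obtain ⟨m, hm, hg⟩ := hi l (ne_of_mem_erase hl)
          exact mem_image.mpr ⟨m, by simp [hm], hg⟩
        have := card_le_card hsub
        rwa [card_erase_of_mem (mem_univ _), ← card_erase_of_mem (mem_univ i)] at this
      obtain ⟨m₀, hm₀, hg₀⟩ := hi (g i) hgi
      have : ({i | ∀ l ≠ a, ∃ m ≠ i, g m = l} : Finset α) = {i, m₀} := by
        ext j
        simp only [mem_filter, mem_univ, true_and, mem_insert, mem_singleton]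
        constructor
        · intro h
          by_contra! hne
          obtain ⟨m, hm, hg⟩ : ∃ m ≠ j, g m = g j := by
            apply h
            intro hja
            apply hs
            intro l
            by_cases hl : l = a
            · exact ⟨j, hja.trans hl.symm⟩
            · obtain ⟨m, -, hm⟩ := hi l hl
              exact ⟨m, hm⟩
          by_cases hmi : m = i
          · subst hmi
            exact hne.2 (hinj (by simp [hne.1]) (by simp [hm₀]) (hg.symm.trans hg₀.symm))
          · exact hm (hinj (by simp [hmi]) (by simp [hne.1]) hg)
        · rintro (rfl | rfl)
          · exact hi
          · intro l hl
            obtain ⟨m, hm, hg⟩ := hi l hl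
            by_cases hmm : m = j
            · subst hmm
              exact ⟨i, hm.symm, hg₀.symm.trans hg⟩
            · exact ⟨m, hmm, hg⟩
      rw [this, card_pair hm₀.symm]
    · have : ({i | ∀ l ≠ a, ∃ m ≠ i, g m = l} : Finset α) = ∅ :=
        filter_eq_empty_iff.mpr fun i _ h => hd ⟨i, h⟩
      rw [this, card_empty]

/-! ### Kuhn triangulation of the box -/

/-- The vertices of the Kuhn simplex with lowest vertex `c`, where `τ j` is the position at which
coordinate `j` is raised. -/
def kuhnVertex {n : ℕ} (c : Fin n → ℕ) (τ : Equiv.Perm (Fin n)) (i : ℕ) : Fin n → ℕ :=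
  fun j => c j + if (τ j : ℕ) < i then 1 else 0

/-- A labelling of the box admitting the boundary conditions of the cubical Sperner lemma. -/
structure IsSpernerLabelling {n : ℕ} (k : Fin n → ℕ) (lab : (Fin n → ℕ) → Fin (n + 1)) : Prop where
  bot : ∀ x ∈ discreteBox k, ∀ j : Fin n, lab x = j.succ → x j ≠ 0
  top : ∀ x ∈ discreteBox k, ∀ j : Fin n, lab x ≤ j.castSucc → x j + 1 ≠ k j

/-- The Kuhn simplices of a box. -/
def kuhnSimplices {n : ℕ} (k : Fin n → ℕ) : Finset ((Fin n → ℕ) × Equiv.Perm (Fin n)) :=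
  Fintype.piFinset (fun j => Finset.range (k j - 1)) ×ˢ Finset.univ

theorem mem_kuhnSimplices {n : ℕ} {k : Fin n → ℕ} {s : (Fin n → ℕ) × Equiv.Perm (Fin n)} :
    s ∈ kuhnSimplices k ↔ ∀ j, s.1 j + 1 < k j := by
  simp only [kuhnSimplices, Finset.mem_product, Fintype.mem_piFinset, Finset.mem_range,
    Finset.mem_univ, and_true]
  exact forall_congr' fun j => by omega

theorem kuhnVertex_mem_discreteBox {n : ℕ} {k : Fin n → ℕ} {s : (Fin n → ℕ) × Equiv.Perm (Fin n)}
    (hs : s ∈ kuhnSimplices k) (i : ℕ) : kuhnVertex s.1 s.2 i ∈ discreteBox k := by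
  intro j
  have := mem_kuhnSimplices.mp hs j
  simp only [kuhnVertex]
  split_ifs <;> omega

theorem dist_kuhnVertex_le_one {n : ℕ} (c : Fin n → ℕ) (τ : Equiv.Perm (Fin n)) (i m : ℕ) :
    dist (kuhnVertex c τ i) (kuhnVertex c τ m) ≤ 1 := by
  refine (dist_pi_le_iff zero_le_one).mpr fun j => ?_
  simp only [kuhnVertex, Nat.dist_eq, Nat.cast_add]
  split_ifs <;> simp

/-! ### Pivoting across facets -/

/-- The simplex on the other side of the facet opposite to vertex `i`. -/
def kuhnPivot {n : ℕ} (p : ((Fin (n + 1) → ℕ) × Equiv.Perm (Fin (n + 1))) × Fin (n + 2)) :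
    ((Fin (n + 1) → ℕ) × Equiv.Perm (Fin (n + 1))) × Fin (n + 2) :=
  if p.2 = 0 then
    ((fun j => p.1.1 j + if p.1.2 j = 0 then 1 else 0, p.1.2.trans (finRotate (n + 1)).symm),
      Fin.last (n + 1))
  else if p.2 = Fin.last (n + 1) then
    ((fun j => p.1.1 j - if p.1.2 j = Fin.last n then 1 else 0, p.1.2.trans (finRotate (n + 1))), 0)
  else
    ((p.1.1, p.1.2.trans (Equiv.swap (Fin.ofNat (n + 1) (p.2 - 1)) (Fin.ofNat (n + 1) p.2))), p.2)

theorem val_finRotate_symm {n : ℕ} (a : Fin (n + 1)) :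
    (((finRotate (n + 1)).symm a : Fin (n + 1)) : ℕ) = if (a : ℕ) = 0 then n else (a : ℕ) - 1 := by
  obtain ⟨b, rfl⟩ := (finRotate (n + 1)).surjective a
  rw [Equiv.symm_apply_apply, coe_finRotate]
  by_cases hb : b = Fin.last n
  · simp [hb]
  · simp [hb]

/-- Facets shared with another simplex of the box. -/
def IsInteriorFacet {n : ℕ} (k : Fin (n + 1) → ℕ)
    (p : ((Fin (n + 1) → ℕ) × Equiv.Perm (Fin (n + 1))) × Fin (n + 2)) : Prop :=
  (p.2 = 0 → ∀ j, p.1.2 j = 0 → p.1.1 j + 2 < k j) ∧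
    (p.2 = Fin.last (n + 1) → ∀ j, p.1.2 j = Fin.last n → p.1.1 j ≠ 0)

/-- Dropping the lowest vertex and dropping the highest are inverse rotations. Interiority keeps the
truncated subtraction in the base point exact. -/
theorem kuhnPivot_kuhnPivot {n : ℕ} {k : Fin (n + 1) → ℕ}
    {p : ((Fin (n + 1) → ℕ) × Equiv.Perm (Fin (n + 1))) × Fin (n + 2)}
    (hp : IsInteriorFacet k p) : kuhnPivot (kuhnPivot p) = p := by
  obtain ⟨⟨c, τ⟩, i⟩ := p
  by_cases h0 : i = 0
  · subst h0
    have : (Fin.last (n + 1)) ≠ 0 := (Fin.last_pos).ne'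
    simp only [kuhnPivot, if_true, this, if_false]
    refine Prod.ext (Prod.ext ?_ ?_) rfl
    · funext j
      have : (finRotate (n + 1)).symm (τ j) = Fin.last n ↔ τ j = 0 := by
        rw [Equiv.symm_apply_eq, finRotate_last]
      simp only [Equiv.trans_apply, this, Nat.add_sub_cancel]
    · ext j; simp
  by_cases h1 : i = Fin.last (n + 1)
  · subst h1
    simp only [kuhnPivot, if_true, h0, if_false]
    refine Prod.ext (Prod.ext ?_ ?_) rfl
    · funext j
      have : finRotate (n + 1) (τ j) = 0 ↔ τ j = Fin.last n := by
        rw [← Equiv.eq_symm_apply, Equiv.eq_symm_apply, ← finRotate_last,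
          (finRotate (n + 1)).injective.eq_iff]
      have h2 := hp.2 rfl j
      simp only [Equiv.trans_apply, this] at h2 ⊢
      split_ifs with h3
      · have := h2 h3
        omega
      · simp
    · ext j; simp
  · simp only [kuhnPivot, h0, h1, if_false]
    refine Prod.ext (Prod.ext rfl ?_) rfl
    ext j; simp

theorem kuhnPivot_ne {n : ℕ} (p : ((Fin (n + 1) → ℕ) × Equiv.Perm (Fin (n + 1))) × Fin (n + 2)) :
    kuhnPivot p ≠ p := by
  obtain ⟨⟨c, τ⟩, i⟩ := p
  have hl : (Fin.last (n + 1)) ≠ 0 := (Fin.last_pos).ne'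
  by_cases h0 : i = 0
  · subst h0
    simp [kuhnPivot]
  by_cases h1 : i = Fin.last (n + 1)
  · subst h1
    simp only [kuhnPivot, if_true, h0, if_false]
    intro h
    exact h0 (congrArg Prod.snd h).symm
  · simp only [kuhnPivot, h0, h1, if_false]
    intro h
    have h2 : τ.trans (Equiv.swap (Fin.ofNat (n + 1) (i - 1)) (Fin.ofNat (n + 1) i)) = τ :=
      congrArg (fun q => q.1.2) h
    have h3 := DFunLike.congr_fun h2 (τ.symm (Fin.ofNat (n + 1) i))
    simp only [Equiv.trans_apply, Equiv.apply_symm_apply, Equiv.swap_apply_right] at h3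
    have h4 := congrArg Fin.val h3
    have h5 : (i : ℕ) ≠ 0 := fun h => h0 (Fin.ext h)
    have h6 : (i : ℕ) ≠ n + 1 := fun h => h1 (Fin.ext h)
    have h7 := i.isLt
    simp only [Fin.ofNat, Nat.mod_eq_of_lt (show (i : ℕ) - 1 < n + 1 by omega),
      Nat.mod_eq_of_lt (show (i : ℕ) < n + 1 by omega)] at h4
    omega

theorem kuhnPivot_mem {n : ℕ} {k : Fin (n + 1) → ℕ}
    {p : ((Fin (n + 1) → ℕ) × Equiv.Perm (Fin (n + 1))) × Fin (n + 2)}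
    (hp : IsInteriorFacet k p) (hs : p.1 ∈ kuhnSimplices k) :
    (kuhnPivot p).1 ∈ kuhnSimplices k := by
  obtain ⟨⟨c, τ⟩, i⟩ := p
  rw [mem_kuhnSimplices] at hs ⊢
  intro j
  have h := hs j
  simp only at h
  by_cases h0 : i = 0
  · have := hp.1 h0 j
    simp only [kuhnPivot, h0, if_true] at this ⊢
    split_ifs with h3
    · have := this h3
      omega
    · omega
  by_cases h1 : i = Fin.last (n + 1)
  · simp only [kuhnPivot, h0, if_false, if_pos h1]
    split_ifs <;> omega
  · simpa only [kuhnPivot, h0, h1, if_false] using h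

theorem isInteriorFacet_kuhnPivot {n : ℕ} {k : Fin (n + 1) → ℕ}
    {p : ((Fin (n + 1) → ℕ) × Equiv.Perm (Fin (n + 1))) × Fin (n + 2)}
    (hp : IsInteriorFacet k p) (hs : p.1 ∈ kuhnSimplices k) :
    IsInteriorFacet k (kuhnPivot p) := by
  obtain ⟨⟨c, τ⟩, i⟩ := p
  rw [mem_kuhnSimplices] at hs
  have hl : (Fin.last (n + 1)) ≠ 0 := (Fin.last_pos).ne'
  by_cases h0 : i = 0
  · simp only [kuhnPivot, h0, if_true, IsInteriorFacet, hl, false_implies, true_and,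
      Equiv.trans_apply, forall_const]
    intro j hj
    rw [Equiv.symm_apply_eq, finRotate_last] at hj
    simp [hj]
  by_cases h1 : i = Fin.last (n + 1)
  · subst h1
    simp only [kuhnPivot, h0, if_true, if_false, IsInteriorFacet, hl.symm, false_implies, and_true,
      Equiv.trans_apply, forall_const]
    intro j hj
    rw [← finRotate_last, (finRotate (n + 1)).injective.eq_iff] at hj
    have h2 := hp.2 rfl j hj
    have h3 := hs j
    simp only [hj, if_true] at h2 h3 ⊢
    omega
  · simp [kuhnPivot, h0, h1, IsInteriorFacet]

/-- A facet is a door if it carries all nonzero labels. -/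
def IsDoor {n : ℕ} (lab : (Fin (n + 1) → ℕ) → Fin (n + 2))
    (p : ((Fin (n + 1) → ℕ) × Equiv.Perm (Fin (n + 1))) × Fin (n + 2)) : Prop :=
  ∀ l ≠ 0, ∃ m ≠ p.2, lab (kuhnVertex p.1.1 p.1.2 m) = l

/-- Pivoting at the lowest vertex shifts indices down by one, at the highest up by one; a middle
pivot swaps two consecutive raises and so changes only vertex `i`. -/
theorem exists_kuhnVertex_kuhnPivot {n : ℕ} {k : Fin (n + 1) → ℕ}
    {p : ((Fin (n + 1) → ℕ) × Equiv.Perm (Fin (n + 1))) × Fin (n + 2)}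
    (hp : IsInteriorFacet k p) (m : Fin (n + 2)) (hm : m ≠ p.2) :
    ∃ m' ≠ (kuhnPivot p).2, kuhnVertex (kuhnPivot p).1.1 (kuhnPivot p).1.2 (m' : Fin (n + 2)) =
      kuhnVertex p.1.1 p.1.2 m := by
  obtain ⟨⟨c, τ⟩, i⟩ := p
  have hl : (Fin.last (n + 1)) ≠ 0 := (Fin.last_pos).ne'
  simp only at hm
  have hmlt := m.isLt
  by_cases h0 : i = 0
  · subst h0
    have hm0 : (m : ℕ) ≠ 0 := fun h => hm (Fin.ext h)
    refine ⟨⟨m - 1, by omega⟩, ?_, ?_⟩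
    · simp only [kuhnPivot, if_true, ne_eq, Fin.ext_iff, Fin.val_last]
      omega
    · funext j
      have hj := (τ j).isLt
      simp only [kuhnPivot, if_true, kuhnVertex, Equiv.trans_apply, val_finRotate_symm,
        Fin.ext_iff, Fin.val_zero]
      split_ifs <;> omega
  by_cases h1 : i = Fin.last (n + 1)
  · subst h1
    have hm0 : (m : ℕ) ≠ n + 1 := fun h => hm (Fin.ext h)
    refine ⟨⟨m + 1, by omega⟩, ?_, ?_⟩
    · simp only [kuhnPivot, h0, if_true, if_false, ne_eq, Fin.ext_iff, Fin.val_zero]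
      omega
    · funext j
      have hj := (τ j).isLt
      have h2 := hp.2 rfl j
      simp only [kuhnPivot, h0, if_true, if_false, kuhnVertex, Equiv.trans_apply, coe_finRotate,
        Fin.ext_iff, Fin.val_last] at h2 ⊢
      split_ifs <;> omega
  · refine ⟨m, by simpa [kuhnPivot, h0, h1] using hm, ?_⟩
    funext j
    have h5 : (i : ℕ) ≠ 0 := fun h => h0 (Fin.ext h)
    have h6 : (i : ℕ) ≠ n + 1 := fun h => h1 (Fin.ext h)
    have h7 := i.isLt
    have h8 : (m : ℕ) ≠ i := fun h => hm (Fin.ext h)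
    simp only [kuhnPivot, h0, h1, if_false, kuhnVertex, Equiv.trans_apply, Equiv.swap_apply_def,
      Fin.ext_iff, Fin.ofNat, Nat.mod_eq_of_lt (show (i : ℕ) - 1 < n + 1 by omega),
      Nat.mod_eq_of_lt (show (i : ℕ) < n + 1 by omega), Nat.add_left_cancel_iff]
    split_ifs <;> simp_all <;> omega

theorem IsDoor.kuhnPivot {n : ℕ} {k : Fin (n + 1) → ℕ} {lab : (Fin (n + 1) → ℕ) → Fin (n + 2)}
    {p : ((Fin (n + 1) → ℕ) × Equiv.Perm (Fin (n + 1))) × Fin (n + 2)}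
    (hd : IsDoor lab p) (hp : IsInteriorFacet k p) : IsDoor lab (kuhnPivot p) := by
  intro l hl
  obtain ⟨m, hm, rfl⟩ := hd l hl
  obtain ⟨m', hm', h⟩ := exists_kuhnVertex_kuhnPivot hp m hm
  exact ⟨m', hm', by rw [h]⟩

open Finset Classical in
theorem even_card_interior_doors {n : ℕ} (k : Fin (n + 1) → ℕ)
    (lab : (Fin (n + 1) → ℕ) → Fin (n + 2)) :
    Even #{p ∈ kuhnSimplices k ×ˢ (univ : Finset (Fin (n + 2))) |
      IsDoor lab p ∧ IsInteriorFacet k p} := by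
  have h : ∑ p ∈ kuhnSimplices k ×ˢ (univ : Finset (Fin (n + 2))) with
      IsDoor lab p ∧ IsInteriorFacet k p, (1 : ZMod 2) = 0 := by
    refine Finset.sum_involution (fun p _ => kuhnPivot p) ?_ ?_ ?_ ?_
    · intro p _
      decide
    · intro p _ _
      exact kuhnPivot_ne p
    · intro p hp
      simp only [mem_filter, mem_product, mem_univ, and_true] at hp ⊢
      exact ⟨kuhnPivot_mem hp.2.2 hp.1, hp.2.1.kuhnPivot hp.2.2,
        isInteriorFacet_kuhnPivot hp.2.2 hp.1⟩
    · intro p hp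
      exact kuhnPivot_kuhnPivot (mem_filter.mp hp).2.2
  rw [sum_const, nsmul_one] at h
  exact (ZMod.natCast_eq_zero_iff_even).mp h

/-! ### Boundary doors and the top face -/

/-- The labelling induced on the top face in direction `0`. -/
def topFaceLabelling {n : ℕ} (k : Fin (n + 1) → ℕ) (lab : (Fin (n + 1) → ℕ) → Fin (n + 2))
    (x : Fin n → ℕ) : Fin (n + 1) :=
  Fin.predAbove 0 (lab (Fin.cons (k 0 - 1) x))

theorem cons_mem_discreteBox {n : ℕ} {k : Fin (n + 1) → ℕ} (hk : 0 < k 0) {x : Fin n → ℕ}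
    (hx : x ∈ discreteBox (fun j => k j.succ)) :
    (Fin.cons (k 0 - 1) x : Fin (n + 1) → ℕ) ∈ discreteBox k := by
  intro j
  induction j using Fin.cases with
  | zero => simp only [Fin.cons_zero]; omega
  | succ j => simpa using hx j

theorem IsSpernerLabelling.succ_topFaceLabelling {n : ℕ} {k : Fin (n + 1) → ℕ}
    {lab : (Fin (n + 1) → ℕ) → Fin (n + 2)} (h : IsSpernerLabelling k lab) (hk : 0 < k 0)
    {x : Fin n → ℕ} (hx : x ∈ discreteBox (fun j => k j.succ)) :
    (topFaceLabelling k lab x).succ = lab (Fin.cons (k 0 - 1) x) := by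
  have h0 : lab (Fin.cons (k 0 - 1) x) ≠ 0 := by
    intro h0
    refine h.top _ (cons_mem_discreteBox hk hx) 0 (by rw [h0]; exact Fin.zero_le _) ?_
    simp only [Fin.cons_zero]
    omega
  obtain ⟨l, hl⟩ := Fin.exists_succ_eq.mpr h0
  rw [topFaceLabelling, ← hl, Fin.predAbove_zero_succ]

theorem IsSpernerLabelling.topFace {n : ℕ} {k : Fin (n + 1) → ℕ}
    {lab : (Fin (n + 1) → ℕ) → Fin (n + 2)} (h : IsSpernerLabelling k lab) (hk : 0 < k 0) :
    IsSpernerLabelling (fun j => k j.succ) (topFaceLabelling k lab) where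
  bot x hx j hj := by
    have := h.bot _ (cons_mem_discreteBox hk hx) j.succ
      (by rw [← h.succ_topFaceLabelling hk hx, hj])
    simpa using this
  top x hx j hj := by
    have := h.top _ (cons_mem_discreteBox hk hx) j.succ (by
      rw [← h.succ_topFaceLabelling hk hx, ← Fin.succ_castSucc, Fin.succ_le_succ_iff]
      exact hj)
    simpa using this

/-- All labels occur at the vertices of the simplex. -/
def IsRainbow {n : ℕ} (lab : (Fin n → ℕ) → Fin (n + 1))
    (s : (Fin n → ℕ) × Equiv.Perm (Fin n)) : Prop :=
  Function.Surjective fun m : Fin (n + 1) => lab (kuhnVertex s.1 s.2 m)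

/-- A boundary facet lies in a face of the box. A face `x j = 0` forbids label `j.succ`, and a top
face with `j ≠ 0` forbids the nonzero label `j.castSucc`. Only the top face in direction `0` can
carry all nonzero labels. -/
theorem IsSpernerLabelling.boundary_door {n : ℕ} {k : Fin (n + 1) → ℕ}
    {lab : (Fin (n + 1) → ℕ) → Fin (n + 2)} (h : IsSpernerLabelling k lab)
    {p : ((Fin (n + 1) → ℕ) × Equiv.Perm (Fin (n + 1))) × Fin (n + 2)}
    (hs : p.1 ∈ kuhnSimplices k) (hd : IsDoor lab p) (hb : ¬ IsInteriorFacet k p) :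
    p.2 = 0 ∧ p.1.2 0 = 0 ∧ p.1.1 0 + 2 = k 0 := by
  obtain ⟨⟨c, τ⟩, i⟩ := p
  have hc := mem_kuhnSimplices.mp hs
  rw [IsInteriorFacet, not_and_or] at hb
  push Not at hb
  rcases hb with ⟨hi, j, hj, hk⟩ | ⟨hi, j, hj, hk⟩
  · simp only at hi hj hk hc
    subst hi
    have hkj : c j + 2 = k j := by have := hc j; omega
    have hj0 : j = 0 := by
      by_contra hne
      have hjpos : (0 : ℕ) < j := Nat.pos_of_ne_zero fun h => hne (Fin.ext h)
      obtain ⟨m, hm, hl⟩ := hd j.castSucc 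
        (fun h => hjpos.ne' (Fin.ext_iff.mp h))
      have hm0 : 0 < (m : ℕ) := Nat.pos_of_ne_zero fun h => hm (Fin.ext h)
      refine h.top _ (kuhnVertex_mem_discreteBox hs m) j hl.le ?_
      simp only [kuhnVertex, hj, Fin.val_zero, hm0, if_true]
      omega
    subst hj0
    exact ⟨rfl, hj, hkj⟩
  · simp only at hi hj hk
    subst hi
    exfalso
    obtain ⟨m, hm, hl⟩ := hd j.succ (Fin.succ_ne_zero j)
    have hm0 : (m : ℕ) ≠ n + 1 := fun h => hm (Fin.ext h)
    have hmlt := m.isLt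
    refine h.bot _ (kuhnVertex_mem_discreteBox hs m) j hl ?_
    have : ¬ n < (m : ℕ) := by omega
    simp [kuhnVertex, hj, hk, this]

theorem kuhnVertex_cons_decomposeFin {n : ℕ} (a : ℕ) (c : Fin n → ℕ) (τ : Equiv.Perm (Fin n))
    (i : ℕ) : kuhnVertex (Fin.cons a c : Fin (n + 1) → ℕ) (Equiv.Perm.decomposeFin.symm (0, τ))
      (i + 1) = (Fin.cons (a + 1) (kuhnVertex c τ i) : Fin (n + 1) → ℕ) := by
  funext j
  induction j using Fin.cases with
  | zero => simp [kuhnVertex]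
  | succ j => simp [kuhnVertex, Equiv.Perm.decomposeFin_symm_apply_succ]

theorem IsSpernerLabelling.isDoor_cons_iff {n : ℕ} {k : Fin (n + 1) → ℕ}
    {lab : (Fin (n + 1) → ℕ) → Fin (n + 2)} (h : IsSpernerLabelling k lab) (hk : 2 ≤ k 0)
    {s : (Fin n → ℕ) × Equiv.Perm (Fin n)} (hs : s ∈ kuhnSimplices fun j => k j.succ) :
    IsDoor lab ((Fin.cons (k 0 - 2) s.1, Equiv.Perm.decomposeFin.symm (0, s.2)), 0) ↔
      IsRainbow (topFaceLabelling k lab) s := by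
  have key : ∀ m : Fin (n + 1), lab (kuhnVertex (Fin.cons (k 0 - 2) s.1 : Fin (n + 1) → ℕ)
      (Equiv.Perm.decomposeFin.symm (0, s.2)) m.succ) =
        (topFaceLabelling k lab (kuhnVertex s.1 s.2 m)).succ := by
    intro m
    rw [h.succ_topFaceLabelling (by omega) (kuhnVertex_mem_discreteBox hs m), Fin.val_succ,
      kuhnVertex_cons_decomposeFin, show k 0 - 2 + 1 = k 0 - 1 by omega]
  constructor
  · intro hd l
    obtain ⟨m, hm, hl⟩ := hd l.succ (Fin.succ_ne_zero l)
    obtain ⟨m, rfl⟩ := Fin.exists_succ_eq.mpr hm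
    exact ⟨m, Fin.succ_injective _ ((key m).symm.trans hl)⟩
  · intro hr l hl
    obtain ⟨l, rfl⟩ := Fin.exists_succ_eq.mpr hl
    obtain ⟨m, hm⟩ := hr l
    exact ⟨m.succ, Fin.succ_ne_zero m, (key m).trans (congrArg Fin.succ hm)⟩

open Finset Classical in
theorem IsSpernerLabelling.card_boundary_doors {n : ℕ} {k : Fin (n + 1) → ℕ}
    {lab : (Fin (n + 1) → ℕ) → Fin (n + 2)} (h : IsSpernerLabelling k lab) (hk : 2 ≤ k 0) :
    #{s ∈ kuhnSimplices fun j => k j.succ | IsRainbow (topFaceLabelling k lab) s} =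
      #{p ∈ kuhnSimplices k ×ˢ (univ : Finset (Fin (n + 2))) |
        IsDoor lab p ∧ ¬ IsInteriorFacet k p} := by
  -- Base coordinate `k 0 - 2`, raised first, puts every vertex but the lowest on the top face.
  refine Finset.card_bij (fun s _ =>
    ((Fin.cons (k 0 - 2) s.1, Equiv.Perm.decomposeFin.symm (0, s.2)), 0)) ?_ ?_ ?_
  · intro s hs
    simp only [mem_filter, mem_product, mem_univ, and_true] at hs ⊢
    refine ⟨?_, (h.isDoor_cons_iff hk hs.1).mpr hs.2, ?_⟩
    · rw [mem_kuhnSimplices]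
      intro j
      induction j using Fin.cases with
      | zero => simp only [Fin.cons_zero]; omega
      | succ j => simpa using mem_kuhnSimplices.mp hs.1 j
    · intro hi
      have := hi.1 rfl 0 (by simp)
      simp only [Fin.cons_zero] at this
      omega
  · intro s _ t _ hst
    simp only [Prod.mk.injEq, and_true, EmbeddingLike.apply_eq_iff_eq, true_and] at hst
    exact Prod.ext (Fin.cons_right_injective _ hst.1) hst.2
  · intro p hp
    simp only [mem_filter, mem_product, mem_univ, and_true] at hp
    obtain ⟨hs, hd, hb⟩ := hp
    obtain ⟨hi, hτ, hc⟩ := h.boundary_door hs hd hb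
    obtain ⟨⟨c, τ⟩, i⟩ := p
    simp only at hi hτ hc hs
    subst hi
    obtain ⟨⟨a, σ⟩, rfl⟩ := Equiv.Perm.decomposeFin.symm.surjective τ
    rw [Equiv.Perm.decomposeFin_symm_apply_zero] at hτ
    subst hτ
    have hcc : (Fin.cons (k 0 - 2) (Fin.tail c) : Fin (n + 1) → ℕ) = c := by
      rw [← hc, Nat.add_sub_cancel, Fin.cons_self_tail]
    have hm : (Fin.tail c, σ) ∈ kuhnSimplices fun j => k j.succ :=
      mem_kuhnSimplices.mpr fun j => mem_kuhnSimplices.mp hs j.succ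
    refine ⟨(Fin.tail c, σ), ?_, by simp only [hcc]⟩
    simp only [mem_filter]
    refine ⟨hm, (h.isDoor_cons_iff hk hm).mp ?_⟩
    simpa only [hcc] using hd

open Finset Classical in
/-- Cubical Sperner lemma: the number of Kuhn simplices carrying all labels is odd. -/
theorem IsSpernerLabelling.odd_card_rainbow {n : ℕ} {k : Fin n → ℕ} (hk : ∀ j, 2 ≤ k j)
    {lab : (Fin n → ℕ) → Fin (n + 1)} (h : IsSpernerLabelling k lab) :
    Odd #{s ∈ kuhnSimplices k | IsRainbow lab s} := by
  induction n with
  | zero =>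
    have : ({s ∈ kuhnSimplices k | IsRainbow lab s}) = univ := by
      refine filter_true_of_mem (fun s _ l => ⟨0, by rw [Fin.fin_one_eq_zero l]; exact Fin.fin_one_eq_zero _⟩) |>.trans ?_
      ext s
      simp [mem_kuhnSimplices]
    rw [this, card_univ]
    simp
  | succ n ih =>
    -- Counted by simplex, the doors have the parity of the rainbow simplices; counted by facet,
    -- that of the boundary doors, which is odd by induction.
    have h1 : #{p ∈ kuhnSimplices k ×ˢ (univ : Finset (Fin (n + 2))) | IsDoor lab p} =
        ∑ s ∈ kuhnSimplices k, #{i : Fin (n + 2) | IsDoor lab (s, i)} := by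
      simp only [card_filter, sum_product]
    have h2 : ∀ s, #{i : Fin (n + 2) | IsDoor lab (s, i)} % 2 =
        (if IsRainbow lab s then 1 else 0) % 2 := by
      intro s
      have := card_doors_mod_two (0 : Fin (n + 2)) fun m => lab (kuhnVertex s.1 s.2 m)
      unfold IsDoor IsRainbow
      split_ifs with hr
      · rw [if_pos hr] at this
        convert this
      · rw [if_neg hr] at this
        convert this
    have h3 : #{p ∈ kuhnSimplices k ×ˢ (univ : Finset (Fin (n + 2))) | IsDoor lab p} % 2 =
        #{s ∈ kuhnSimplices k | IsRainbow lab s} % 2 := by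
      rw [h1, card_filter, sum_nat_mod, sum_congr rfl fun s _ => h2 s, ← sum_nat_mod]
    have h4 := card_filter_add_card_filter_not
      (s := {p ∈ kuhnSimplices k ×ˢ (univ : Finset (Fin (n + 2))) | IsDoor lab p})
      (p := IsInteriorFacet k)
    rw [filter_filter, filter_filter, ← h.card_boundary_doors (hk 0)] at h4
    have h5 := even_card_interior_doors k lab
    have h6 := ih (fun j => hk j.succ) (h.topFace (by have := hk 0; omega))
    rw [Nat.odd_iff] at h6 ⊢
    rw [Nat.even_iff] at h5
    omega

theorem IsSpernerLabelling.exists_rainbow {n : ℕ} {k : Fin n → ℕ} (hk : ∀ j, 2 ≤ k j)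
    {lab : (Fin n → ℕ) → Fin (n + 1)} (h : IsSpernerLabelling k lab) :
    ∃ s ∈ kuhnSimplices k, IsRainbow lab s := by
  classical
  obtain ⟨s, hs⟩ := Finset.card_pos.mp (h.odd_card_rainbow hk).pos
  exact ⟨s, Finset.mem_filter.mp hs⟩

/-! ### Chain components and their labels -/

/-- Points of `A` at distance at most one. -/
def UnitStep {n : ℕ} (A : Set (Fin n → ℕ)) (x y : Fin n → ℕ) : Prop :=
  x ∈ A ∧ y ∈ A ∧ dist x y ≤ 1

theorem exists_unitStep_path {n : ℕ} {A : Set (Fin n → ℕ)} {a b : Fin n → ℕ} (hb : b ∈ A)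
    (h : Relation.ReflTransGen (UnitStep A) a b) :
    ∃ (m : ℕ) (x : Fin (m + 1) → (Fin n → ℕ)), (∀ j, x j ∈ A) ∧ x 0 = a ∧ x (Fin.last m) = b ∧
      ∀ j : Fin m, dist (x j.castSucc) (x j.succ) ≤ 1 := by
  induction h using Relation.ReflTransGen.head_induction_on with
  | refl => exact ⟨0, fun _ => b, fun _ => hb, rfl, rfl, fun j => j.elim0⟩
  | @head a c hac _ ih =>
    obtain ⟨m, x, hx, h0, hl, hd⟩ := ih
    refine ⟨m + 1, Fin.cons a x, ?_, Fin.cons_zero _ _, ?_, ?_⟩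
    · intro j
      induction j using Fin.cases with
      | zero => exact hac.1
      | succ j => simpa using hx j
    · rw [← Fin.succ_last, Fin.cons_succ, hl]
    · intro j
      induction j using Fin.cases with
      | zero => simpa [h0] using hac.2.2
      | succ j => simpa [← Fin.succ_castSucc] using hd j

/-- The label of a set: one more than the largest coordinate `j` for which the set misses the face
`x j = 0`, and `0` if it meets all of these faces. -/
noncomputable def faceLabel {n : ℕ} (C : Set (Fin n → ℕ)) : Fin (n + 1) := by
  classical
  exact ({j : Fin n | ∀ y ∈ C, y j ≠ 0} : Finset (Fin n)).sup Fin.succ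

theorem ne_zero_of_faceLabel_eq_succ {n : ℕ} {C : Set (Fin n → ℕ)} {j : Fin n}
    (h : faceLabel C = j.succ) : ∀ y ∈ C, y j ≠ 0 := by
  classical
  rw [faceLabel] at h
  have hne : ({j : Fin n | ∀ y ∈ C, y j ≠ 0} : Finset (Fin n)).Nonempty := by
    by_contra hne
    rw [Finset.not_nonempty_iff_eq_empty] at hne
    rw [hne, Finset.sup_empty] at h
    exact Fin.succ_ne_zero j h.symm
  obtain ⟨i, hi, hij⟩ := Finset.exists_mem_eq_sup _ hne Fin.succ
  rw [hij, Fin.succ_inj] at h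
  subst h
  exact (Finset.mem_filter.mp hi).2

theorem exists_eq_zero_of_faceLabel_le {n : ℕ} {C : Set (Fin n → ℕ)} {j : Fin n}
    (h : faceLabel C ≤ j.castSucc) : ∃ y ∈ C, y j = 0 := by
  classical
  by_contra! hc
  rw [faceLabel] at h
  have := (Finset.le_sup (f := Fin.succ)
    (Finset.mem_filter.mpr ⟨Finset.mem_univ j, hc⟩)).trans h
  exact absurd this (not_le.mpr Fin.castSucc_lt_succ)

theorem theorem4p1 (n : ℕ) (k : Fin n → ℕ) (hk : ∀ i, 0 < k i)
    (F : Set (Set (Fin n → ℕ))) (hF : ⋃₀ F = discreteBox k) :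
    (∃ A ∈ F, ConnectsOppositeFaces k A) ∨
      ∃ B ⊆ discreteBox k, Metric.diam B ≤ 1 ∧
        ((n + 1 : ℕ) : ℕ∞) ≤ {A ∈ F | (A ∩ B).Nonempty}.encard := by
  by_cases hcon : ∃ A ∈ F, ConnectsOppositeFaces k A
  · exact Or.inl hcon
  right
  have hcover : ∀ x, ∃ A, x ∈ discreteBox k → A ∈ F ∧ x ∈ A := by
    intro x
    by_cases hx : x ∈ discreteBox k
    · rw [← hF] at hx
      obtain ⟨A, hA, hxA⟩ := hx
      exact ⟨A, fun _ => ⟨hA, hxA⟩⟩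
    · exact ⟨∅, fun h => absurd h hx⟩
  choose A hA using hcover
  have hk2 : ∀ j, 2 ≤ k j := by
    intro j
    by_contra! hj
    -- In a side of length 1 the opposite faces coincide, so a one-point path connects them.
    have h1 : k j = 1 := by have := hk j; omega
    obtain ⟨hAF, h0⟩ := hA 0 hk
    exact hcon ⟨A 0, hAF, j, 0, fun _ => 0, fun _ => h0, rfl, by simp [h1], fun i => i.elim0⟩
  set comp : (Fin n → ℕ) → Set (Fin n → ℕ) :=
    fun x => {y | Relation.ReflTransGen (UnitStep (A x)) y x} with hcomp
  have hlab : IsSpernerLabelling k fun x => faceLabel (comp x) := by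
    refine ⟨fun x _ j hj => ne_zero_of_faceLabel_eq_succ hj x Relation.ReflTransGen.refl,
      fun x hx j hj htop => ?_⟩
    obtain ⟨y, hy, hy0⟩ := exists_eq_zero_of_faceLabel_le hj
    obtain ⟨m, p, hp, h0, hl, hd⟩ := exists_unitStep_path (hA x hx).2 hy
    exact hcon ⟨A x, (hA x hx).1, j, m, p, hp, by rw [h0, hy0], by rw [hl, htop], hd⟩
  obtain ⟨s, hs, hr⟩ := hlab.exists_rainbow hk2
  choose m hm using hr
  set v : Fin (n + 1) → (Fin n → ℕ) := fun l => kuhnVertex s.1 s.2 (m l) with hv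
  have hvbox : ∀ l, v l ∈ discreteBox k := fun l => kuhnVertex_mem_discreteBox hs _
  have hdist : ∀ l l', dist (v l) (v l') ≤ 1 := fun l l' => dist_kuhnVertex_le_one _ _ _ _
  -- Vertices of one simplex are within distance 1, so one more step links their components.
  have hcomp_sub : ∀ l l', A (v l) = A (v l') → comp (v l) ⊆ comp (v l') := by
    intro l l' h y hy
    have hl := (hA _ (hvbox l)).2
    have hl' := (hA _ (hvbox l')).2
    simp only [hcomp, Set.mem_ofPred_eq] at hy ⊢
    rw [h] at hy hl
    exact hy.tail ⟨hl, hl', hdist l l'⟩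
  have hinj : Function.Injective fun l => A (v l) := by
    intro l l' h
    rw [← hm l, ← hm l']
    exact congrArg faceLabel ((hcomp_sub l l' h).antisymm (hcomp_sub l' l h.symm))
  refine ⟨Set.range v, Set.range_subset_iff.mpr hvbox, ?_, ?_⟩
  · refine Metric.diam_le_of_forall_dist_le zero_le_one ?_
    rintro _ ⟨l, rfl⟩ _ ⟨l', rfl⟩
    exact hdist l l'
  · have hcard : (Set.range fun l => A (v l)).encard = ((n + 1 : ℕ) : ℕ∞) := by
      rw [← Set.image_univ, hinj.encard_image, Set.encard_univ, ENat.card_eq_coe_fintype_card,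
        Fintype.card_fin]
    rw [← hcard]
    refine Set.encard_le_encard ?_
    rintro _ ⟨l, rfl⟩
    exact ⟨(hA _ (hvbox l)).1, v l, (hA _ (hvbox l)).2, l, rfl⟩
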